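/- Let $a<b$, let $L^2=L^2(a,b)$ be the real Hilbert space with inner product $(\cdot,\cdot)$ and norm $\|\cdot\|$, and let $B$ be its closed unit ball. Let $Kf(x)=\int_a^b K(x,y)f(y)\,\mathrm{d}y$ be an integral operator on $L^2$ whose kernel is square-integrable on $(a,b)^2$ (for instance continuous or piecewise continuous), and let $K^*$ be its adjoint. Let $\lambda_1\ge\lambda_2\ge\cdots\ge 0$ be the eigenvalues of $K^*K$ and of $KK^*$ (all nonzero eigenvalues, repeated according to multiplicity, followed by zeros if there are only finitely many of them), with orthonormal eigenfunctions $K^*K\phi_l=\lambda_l\phi_l$ and $KK^*\psi_l=\lambda_l\psi_l$, $l\ge 1$. Put $A^0=\{u\in B: u\perp\ker K^*\}$, $A^0_*=\{u\in B: u\perp\ker K\}$, $A^1=A=K(B)$, $A^1_*=A_*=K^*(B)$ and, for $r\ge2$, $A^r=K(A^{r-1}_*)$, $A^r_*=K^*(A^{r-1})$. Let $\partial$ denote the (weak) derivative, and assume that $\partial Kf=f$ for all $f\in A^r_*$ and $\partial K^*f=-f$ for all $f\in A^r$, for every $r\ge 0$. For $S\subset L^2$ and a finite-dimensional subspace $\mathbb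 X\subset L^2$ with $L^2$-projector $X$ let $E(S,\mathbb X)=\sup_{u\in S}\|u-Xu\|$, and let $d_n(S)=\inf_{\dim\mathbb X=n}E(S,\mathbb X)$ be the Kolmogorov $n$-width of $S$. The space $\mathbb X$ is called optimal for the $n$-width of $S$ if $\dim\mathbb X\le n$ and $E(S,\mathbb X)=d_n(S)$. Let $n\ge 0$, let $\mathbb X_0$ be optimal for the $n$-width of $A$ and $\mathbb Y_0$ be optimal for the $n$-width of $A_*$, with $\mathbb X_0\perp\ker K^*$ and $\mathbb Y_0\perp\ker K$. For $\bar p\ge1$ put $\mathbb X_{\bar p}=K(\mathbb Y_{\bar p-1})$ and $\mathbb Y_{\bar p}=K^*(\mathbb X_{\bar p-1})$; for $\bar p\ge 0$ let $X_{\bar p},Y_{\bar p}$ be the $L^2$-projectors onto $\mathbb X_{\bar p},\mathbb Y_{\bar p}$; and for $\bar p\ge 1$ let $$R_{\mathbb X_{\bar p}}=KY_{\bar p-1}\partial \text{ on } K(L^2),\qquad R_{\mathbb Y_{\bar p}}=-K^*X_{\bar p-1}\partial\text{ on } K^*(L^2)$$ be the Ritz projectors. Then, for every $\bar p\ge1$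 and every $l\ge1$ with $\lambda_l>0$, we have $\psi_l\in K(L^2)$ and $\phi_l\in K^*(L^2)$, the functions $\psi_l$, $\phi_l$, $(I-R_{\mathbb X_{\bar p}})\psi_l$, $(I-R_{\mathbb Y_{\bar p}})\phi_l$ have weak derivatives in $L^2$, the functions $\psi_l,\phi_l,\partial\psi_l,\partial\phi_l$ are nonzero, and $$\frac{\|(I-R_{\mathbb X_{\bar p}})\psi_l\|}{\|\psi_l\|}\le\Big(\frac{\lambda_{n+1}}{\lambda_l}\Big)^{(\bar p+1)/2},\qquad \frac{\|\partial(I-R_{\mathbb X_{\bar p}})\psi_l\|}{\|\partial\psi_l\|}\le\Big(\frac{\lambda_{n+1}}{\lambda_l}\Big)^{\bar p/2},$$ $$\frac{\|(I-R_{\mathbb Y_{\bar p}})\phi_l\|}{\|\phi_l\|}\le\Big(\frac{\lambda_{n+1}}{\lambda_l}\Big)^{(\bar p+1)/2},\qquad \frac{\|\partial(I-R_{\mathbb Y_{\bar p}})\phi_l\|}{\|\partial\phi_l\|}\le\Big(\frac{\lambda_{n+1}}{\lambda_l}\Big)^{\bar p/2}.$$ -/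

import Mathlib

open MeasureTheory Set
open scoped ENNReal ContDiff

noncomputable section

/-! ### Kolmogorov widths, iterated function classes, iterated subspaces -/

section Hilbert

variable {E : Type*} [NormedAddCommGroup E] [InnerProductSpace ℝ E]

/-- `E(A, X) = sup_{u ∈ A} ‖u - P_X u‖`, where `P_X` is the orthogonal projector onto the
finite-dimensional subspace `X`. -/
def distE (A : Set E) (X : Submodule ℝ E) [FiniteDimensional ℝ X] : ℝ≥0∞ :=
  ⨆ u ∈ A, ‖u - X.starProjection u‖ₑ

/-- The Kolmogorov `n`-width `d_n(A)`: the infimum of `E(A, X)` over all subspaces `X` of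
dimension exactly `n`. -/
def nWidth (n : ℕ) (A : Set E) : ℝ≥0∞ :=
  ⨅ (X : Submodule ℝ E) (_ : FiniteDimensional ℝ X) (_ : Module.finrank ℝ X = n), distE A X

/-- `X` is an optimal subspace for the `n`-width of `A`. -/
def IsOptimalSubspace (n : ℕ) (A : Set E) (X : Submodule ℝ E) [FiniteDimensional ℝ X] : Prop :=
  Module.finrank ℝ X ≤ n ∧ nWidth n A = distE A X

/-- `lam 0 ≥ lam 1 ≥ ⋯ ≥ 0` is the list of eigenvalues of `T`, with corresponding orthonormal
eigenvectors `e 0, e 1, …`; the list contains every nonzero eigenvalue with its full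
multiplicity. -/
structure IsEigenSystem (T : E →L[ℝ] E) (lam : ℕ → ℝ) (e : ℕ → E) : Prop where
  antitone : Antitone lam
  nonneg : ∀ l, 0 ≤ lam l
  orthonormal : Orthonormal ℝ e
  apply_eq : ∀ l, T (e l) = lam l • e l
  complete : ∀ (c : ℝ) (v : E), c ≠ 0 → T v = c • v → v ∈ Submodule.span ℝ (e '' {l | lam l = c})

variable [CompleteSpace E]

/-- The pair of function classes `(A^r, A^r_*)` of the operator `K`. For `r = 0` these are the
parts of the closed unit ball orthogonal to `ker K*` and to `ker K`. -/
def classPair (K : E →L[ℝ] E) : ℕ → Set E × Set E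
  | 0 => ({u | ‖u‖ ≤ 1 ∧ u ∈ (LinearMap.ker (K.adjoint : E →ₗ[ℝ] E))ᗮ},
      {u | ‖u‖ ≤ 1 ∧ u ∈ (LinearMap.ker (K : E →ₗ[ℝ] E))ᗮ})
  | 1 => (K '' Metric.closedBall 0 1, K.adjoint '' Metric.closedBall 0 1)
  | r + 2 => (K '' (classPair K (r + 1)).2, K.adjoint '' (classPair K (r + 1)).1)

/-- The class `A^r`. -/
def classA (K : E →L[ℝ] E) (r : ℕ) : Set E := (classPair K r).1

/-- The class `A^r_*`. -/
def classAstar (K : E →L[ℝ] E) (r : ℕ) : Set E := (classPair K r).2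

/-- The pair of subspaces `(𝕏_p, 𝕐_p)` generated from `(𝕏_0, 𝕐_0)` by
`𝕏_p = K(𝕐_{p-1})`, `𝕐_p = K*(𝕏_{p-1})`. -/
def spacePair (K : E →L[ℝ] E) (X₀ Y₀ : Submodule ℝ E) : ℕ → Submodule ℝ E × Submodule ℝ E
  | 0 => (X₀, Y₀)
  | p + 1 => ((spacePair K X₀ Y₀ p).2.map (K : E →ₗ[ℝ] E),
      (spacePair K X₀ Y₀ p).1.map (K.adjoint : E →ₗ[ℝ] E))

/-- The subspace `𝕏_p`. -/
def spaceX (K : E →L[ℝ] E) (X₀ Y₀ : Submodule ℝ E) (p : ℕ) : Submodule ℝ E :=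
  (spacePair K X₀ Y₀ p).1

/-- The subspace `𝕐_p`. -/
def spaceY (K : E →L[ℝ] E) (X₀ Y₀ : Submodule ℝ E) (p : ℕ) : Submodule ℝ E :=
  (spacePair K X₀ Y₀ p).2

theorem finiteDimensional_spacePair (K : E →L[ℝ] E) (X₀ Y₀ : Submodule ℝ E)
    [FiniteDimensional ℝ X₀] [FiniteDimensional ℝ Y₀] (p : ℕ) :
    FiniteDimensional ℝ (spacePair K X₀ Y₀ p).1 ∧ FiniteDimensional ℝ (spacePair K X₀ Y₀ p).2 := by
  induction p with
  | zero => exact ⟨‹_›, ‹_›⟩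
  | succ p ih =>
    obtain ⟨h1, h2⟩ := ih
    exact ⟨Module.Finite.map _ _, Module.Finite.map _ _⟩

instance (K : E →L[ℝ] E) (X₀ Y₀ : Submodule ℝ E)
    [FiniteDimensional ℝ X₀] [FiniteDimensional ℝ Y₀] (p : ℕ) :
    FiniteDimensional ℝ (spaceX K X₀ Y₀ p) := (finiteDimensional_spacePair K X₀ Y₀ p).1

instance (K : E →L[ℝ] E) (X₀ Y₀ : Submodule ℝ E)
    [FiniteDimensional ℝ X₀] [FiniteDimensional ℝ Y₀] (p : ℕ) :
    FiniteDimensional ℝ (spaceY K X₀ Y₀ p) := (finiteDimensional_spacePair K X₀ Y₀ p).2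

end Hilbert

/-! ### Integral operators on `L²(a,b)` -/

/-- Lebesgue measure on the interval `(a,b)`. -/
abbrev volIoo (a b : ℝ) : Measure ℝ := volume.restrict (Ioo a b)

/-- The real Hilbert space `L²(a,b)`. -/
abbrev L2Ioo (a b : ℝ) : Type := Lp ℝ 2 (volIoo a b)

section IntegralOperator

variable {a b : ℝ} {k : ℝ × ℝ → ℝ}

theorem kernel_section_memLp (hk : MemLp k 2 ((volIoo a b).prod (volIoo a b))) :
    ∀ᵐ x ∂(volIoo a b), MemLp (fun y => k (x, y)) 2 (volIoo a b) := by
  have h1 := hk.integrable_sq.prod_right_ae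
  have h2 := hk.1.prodMk_left
  filter_upwards [h1, h2] with x hx1 hx2
  exact (memLp_two_iff_integrable_sq hx2).2 hx1

theorem norm_sq_L2Ioo (g : L2Ioo a b) : ‖g‖ ^ 2 = ∫ y, (g y) ^ 2 ∂(volIoo a b) := by
  rw [← real_inner_self_eq_norm_sq, L2.inner_def]
  simp [pow_two]

theorem kernel_apply_sq_le {g : ℝ → ℝ} (hg : MemLp g 2 (volIoo a b)) (f : L2Ioo a b) :
    (∫ y, g y * f y ∂(volIoo a b)) ^ 2 ≤ (∫ y, (g y) ^ 2 ∂(volIoo a b)) * ‖f‖ ^ 2 := by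
  have h1 : ∫ y, g y * f y ∂(volIoo a b) = inner ℝ (hg.toLp g) f := by
    rw [L2.inner_def]
    apply integral_congr_ae
    filter_upwards [hg.coeFn_toLp] with y hy
    simp [hy, mul_comm]
  have h2 : ∫ y, (g y) ^ 2 ∂(volIoo a b) = ‖hg.toLp g‖ ^ 2 := by
    rw [norm_sq_L2Ioo]
    apply integral_congr_ae
    filter_upwards [hg.coeFn_toLp] with y hy
    simp [hy]
  rw [h1, h2, ← mul_pow, ← sq_abs]
  exact pow_le_pow_left₀ (abs_nonneg _) (abs_real_inner_le_norm _ _) 2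

theorem kernel_apply_aestronglyMeasurable (hk : MemLp k 2 ((volIoo a b).prod (volIoo a b)))
    (f : L2Ioo a b) :
    AEStronglyMeasurable (fun x => ∫ y, k (x, y) * f y ∂(volIoo a b)) (volIoo a b) :=
  (hk.1.mul (Lp.aestronglyMeasurable f).comp_snd).integral_prod_right'

theorem kernel_apply_ae_le (hk : MemLp k 2 ((volIoo a b).prod (volIoo a b))) (f : L2Ioo a b) :
    ∀ᵐ x ∂(volIoo a b), (∫ y, k (x, y) * f y ∂(volIoo a b)) ^ 2 ≤
      (∫ y, k (x, y) ^ 2 ∂(volIoo a b)) * ‖f‖ ^ 2 := by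
  filter_upwards [kernel_section_memLp hk] with x hx
  exact kernel_apply_sq_le hx f

theorem kernel_apply_memLp (hk : MemLp k 2 ((volIoo a b).prod (volIoo a b))) (f : L2Ioo a b) :
    MemLp (fun x => ∫ y, k (x, y) * f y ∂(volIoo a b)) 2 (volIoo a b) := by
  have hm := kernel_apply_aestronglyMeasurable hk f
  refine (memLp_two_iff_integrable_sq hm).2 ?_
  refine (hk.integrable_sq.integral_prod_left.mul_const (‖f‖ ^ 2)).mono' (hm.pow 2) ?_
  filter_upwards [kernel_apply_ae_le hk f] with x hx
  simpa using hx

theorem kernel_mul_integrable (hk : MemLp k 2 ((volIoo a b).prod (volIoo a b))) (f : L2Ioo a b) :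
    ∀ᵐ x ∂(volIoo a b), Integrable (fun y => k (x, y) * f y) (volIoo a b) := by
  filter_upwards [kernel_section_memLp hk] with x hx
  exact hx.integrable_mul (Lp.memLp f)

/-- The integral operator `K f(x) = ∫_a^b k(x,y) f(y) dy` on `L²(a,b)` with a square-integrable
kernel `k`; in particular `k` may be any continuous or piecewise continuous kernel. -/
def integralOp (hk : MemLp k 2 ((volIoo a b).prod (volIoo a b))) : L2Ioo a b →L[ℝ] L2Ioo a b :=
  LinearMap.mkContinuous
    { toFun := fun f => (kernel_apply_memLp hk f).toLp
        (fun x => ∫ y, k (x, y) * f y ∂(volIoo a b))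
      map_add' := fun f g => by
        rw [← MemLp.toLp_add]
        refine MemLp.toLp_congr _ _ ?_
        filter_upwards [kernel_mul_integrable hk f, kernel_mul_integrable hk g] with x hf hg
        simp only [Pi.add_apply]
        rw [← integral_add hf hg]
        apply integral_congr_ae
        filter_upwards [Lp.coeFn_add f g] with y hy
        rw [hy, Pi.add_apply, mul_add]
      map_smul' := fun c f => by
        rw [RingHom.id_apply, ← MemLp.toLp_const_smul]
        refine MemLp.toLp_congr _ _ (Filter.Eventually.of_forall fun x => ?_)
        simp only [Pi.smul_apply, smul_eq_mul]
        rw [← integral_const_mul]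
        apply integral_congr_ae
        filter_upwards [Lp.coeFn_smul c f] with y hy
        rw [hy, Pi.smul_apply, smul_eq_mul]
        ring }
    (Real.sqrt (∫ x, ∫ y, k (x, y) ^ 2 ∂(volIoo a b) ∂(volIoo a b)))
    (fun f => by
      have h0 : 0 ≤ ∫ x, ∫ y, k (x, y) ^ 2 ∂(volIoo a b) ∂(volIoo a b) :=
        integral_nonneg fun x => integral_nonneg fun y => sq_nonneg _
      refine le_of_sq_le_sq ?_ (by positivity)
      rw [mul_pow, Real.sq_sqrt h0, norm_sq_L2Ioo, ← integral_mul_const]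
      have hF := kernel_apply_memLp hk f
      refine integral_mono_ae (Lp.memLp _).integrable_sq
        (hk.integrable_sq.integral_prod_left.mul_const (‖f‖ ^ 2)) ?_
      filter_upwards [kernel_apply_ae_le hk f, hF.coeFn_toLp] with x hx hx'
      simp only [LinearMap.coe_mk, AddHom.coe_mk]
      rw [hx']
      exact hx)

theorem integralOp_apply_ae (hk : MemLp k 2 ((volIoo a b).prod (volIoo a b))) (f : L2Ioo a b) :
    integralOp hk f =ᵐ[volIoo a b] fun x => ∫ y in Ioo a b, k (x, y) * f y :=
  (kernel_apply_memLp hk f).coeFn_toLp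

end IntegralOperator

/-! ### The derivative operator -/

section Derivative

variable {a b : ℝ}

/-- `v ∈ L²(a,b)` is the (weak) derivative of `u ∈ L²(a,b)`. -/
def HasWeakDeriv (u v : L2Ioo a b) : Prop :=
  ∀ η : ℝ → ℝ, ContDiff ℝ ∞ η → HasCompactSupport η → tsupport η ⊆ Ioo a b →
    ∫ x in Ioo a b, u x * deriv η x = -∫ x in Ioo a b, v x * η x

theorem HasWeakDeriv.unique {u v w : L2Ioo a b} (hv : HasWeakDeriv u v) (hw : HasWeakDeriv u w) :
    v = w := by
  have hloc : LocallyIntegrableOn (fun x => v x - w x) (Ioo a b) (volIoo a b) :=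
    (((Lp.memLp v).sub (Lp.memLp w)).integrable (by norm_num)).locallyIntegrable.locallyIntegrableOn _
  have key := isOpen_Ioo.ae_eq_zero_of_integral_contDiff_smul_eq_zero hloc (fun η h1 h2 h3 => by
    have hη : MemLp η 2 (volIoo a b) := h1.continuous.memLp_of_hasCompactSupport h2
    have e := (hv η h1 h2 h3).symm.trans (hw η h1 h2 h3)
    have i1 : Integrable (fun x => v x * η x) (volIoo a b) := (Lp.memLp v).integrable_mul hη
    have i2 : Integrable (fun x => w x * η x) (volIoo a b) := (Lp.memLp w).integrable_mul hη
    have : ∀ x, η x • (v x - w x) = v x * η x - w x * η x := fun x => by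
      rw [smul_eq_mul]; ring
    simp only [this]
    rw [integral_sub i1 i2]
    linarith)
  apply Lp.ext
  filter_upwards [key, ae_restrict_mem measurableSet_Ioo] with x hx hx'
  exact sub_eq_zero.1 (hx hx')

open Classical in
/-- The derivative operator `∂`: `∂ u` is the weak derivative of `u` whenever `u ∈ H¹(a,b)`. -/
def weakDeriv (u : L2Ioo a b) : L2Ioo a b :=
  if h : ∃ v, HasWeakDeriv u v then h.choose else 0

theorem HasWeakDeriv.weakDeriv_eq {u v : L2Ioo a b} (h : HasWeakDeriv u v) : weakDeriv u = v := by
  have h' : ∃ v, HasWeakDeriv u v := ⟨v, h⟩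
  rw [weakDeriv, dif_pos h']
  exact h'.choose_spec.unique h

/-- `u ∈ H¹(a,b)`. -/
def MemH1 (u : L2Ioo a b) : Prop := ∃ v, HasWeakDeriv u v

/-- The condition that `∂ K` is the identity on every `A^r_*` and `∂ K*` is minus the identity on
every `A^r`, `r ≥ 0`. -/
def DerivInvertsOp (K : L2Ioo a b →L[ℝ] L2Ioo a b) : Prop :=
  ∀ r : ℕ, (∀ f ∈ classAstar K r, HasWeakDeriv (K f) f) ∧
    (∀ f ∈ classA K r, HasWeakDeriv (K.adjoint f) (-f))

/-- The Ritz projector `R_{𝕏_p} = K Y_{p-1} ∂` for `p ≥ 1`; it is meant for arguments in the range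
of `K`. -/
def ritzX (K : L2Ioo a b →L[ℝ] L2Ioo a b) (X₀ Y₀ : Submodule ℝ (L2Ioo a b))
    [FiniteDimensional ℝ X₀] [FiniteDimensional ℝ Y₀] (p : ℕ) (u : L2Ioo a b) : L2Ioo a b :=
  K ((spaceY K X₀ Y₀ (p - 1)).starProjection (weakDeriv u))

/-- The Ritz projector `R_{𝕐_p} = -K* X_{p-1} ∂` for `p ≥ 1`; it is meant for arguments in the
range of `K*`. -/
def ritzY (K : L2Ioo a b →L[ℝ] L2Ioo a b) (X₀ Y₀ : Submodule ℝ (L2Ioo a b))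
    [FiniteDimensional ℝ X₀] [FiniteDimensional ℝ Y₀] (p : ℕ) (u : L2Ioo a b) : L2Ioo a b :=
  -K.adjoint ((spaceX K X₀ Y₀ (p - 1)).starProjection (weakDeriv u))

end Derivative

end

/-! With `s = √(lam n)`, optimality of `X₀` and `Y₀` enters only through two bounds: `‖K* w‖ ≤ s
‖w‖` on `X₀ᗮ` and `‖K w‖ ≤ s ‖w‖` on `Y₀ᗮ`. These combine the width bound given by the span of the
first `n` eigenfunctions (`K` is compact) with the duality between `(I - X)K` and `K*(I - X)`. Both
bounds pass to every `𝕏_q`, `𝕐_q` with the same `s` (`norm_apply_le_of_mem_orthogonal_space`),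
because `K*` maps `K(𝕐)ᗮ` into `𝕐ᗮ`. For an eigenfunction with eigenvalue `μ`, each level then
improves the projection error by a factor `s / √μ` (`norm_eigen_sub_starProjection_le`). Finally, `ψ
= K g` with `g ⟂ ker K` an eigenfunction of `K*K` and `∂ψ = g`. The Ritz error is `K z` with `z = g
- Y g`, and its derivative is `z`. Bounding `z` gives the derivative estimate; applying `K` to `z ⟂
𝕐` gains one more factor (`ritz_error_le`). -/

/-! ### Compactness of Hilbert–Schmidt integral operators. -/

section HilbertSchmidt

variable {E F : Type*} [NormedAddCommGroup E] [InnerProductSpace ℝ E]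
  [NormedAddCommGroup F] [InnerProductSpace ℝ F]

/-- Cauchy–Schwarz in the index followed by Bessel. This controls the tails of a rank-one expansion
in operator norm. -/
theorem norm_sum_smulRight_sq_le {ι : Type*} {e : ι → E} (he : Orthonormal ℝ e) (v : ι → F)
    (s : Finset ι) :
    ‖∑ i ∈ s, (innerSL ℝ (e i)).smulRight (v i)‖ ^ 2 ≤ ∑ i ∈ s, ‖v i‖ ^ 2 := by
  have h0 : 0 ≤ ∑ i ∈ s, ‖v i‖ ^ 2 := Finset.sum_nonneg fun i _ => sq_nonneg _
  rw [← Real.le_sqrt (norm_nonneg _) h0]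
  refine ContinuousLinearMap.opNorm_le_bound _ (Real.sqrt_nonneg _) fun x => ?_
  have h1 : ‖∑ i ∈ s, (inner ℝ (e i) x) • v i‖ ≤ ∑ i ∈ s, ‖v i‖ * ‖inner ℝ (e i) x‖ := by
    refine (norm_sum_le _ _).trans (Finset.sum_le_sum fun i _ => ?_)
    rw [norm_smul, mul_comm]
  have h2 := Finset.sum_mul_sq_le_sq_mul_sq s (fun i => ‖v i‖) (fun i => ‖inner ℝ (e i) x‖)
  have h3 := he.sum_inner_products_le x (s := s)
  have h4 : (∑ i ∈ s, ‖v i‖ * ‖inner ℝ (e i) x‖) ^ 2 ≤ (∑ i ∈ s, ‖v i‖ ^ 2) * ‖x‖ ^ 2 :=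
    h2.trans (mul_le_mul_of_nonneg_left h3 h0)
  have h5 : ∑ i ∈ s, ‖v i‖ * ‖inner ℝ (e i) x‖ ≤ √(∑ i ∈ s, ‖v i‖ ^ 2) * ‖x‖ := by
    refine le_of_sq_le_sq ?_ (by positivity)
    rwa [mul_pow, Real.sq_sqrt h0]
  simpa using h1.trans h5

/-- A bounded operator with square-summable images of a Hilbert basis is compact. -/
theorem isCompactOperator_of_summable_norm_sq [CompleteSpace F] {ι : Type*}
    (e : HilbertBasis ι ℝ E) (T : E →L[ℝ] F) (hT : Summable fun i => ‖T (e i)‖ ^ 2) :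
    IsCompactOperator T := by
  -- The rank-one pieces of `T` sum to `T` in operator norm, and compact operators form a closed
  -- set.
  set S : ι → E →L[ℝ] F := fun i => (innerSL ℝ (e i)).smulRight (T (e i)) with hS
  have hsum : Summable S := by
    rw [summable_iff_vanishing_norm]
    intro ε hε
    obtain ⟨s, hs⟩ := summable_iff_vanishing_norm.1 hT (ε ^ 2) (by positivity)
    refine ⟨s, fun t ht => lt_of_pow_lt_pow_left₀ 2 hε.le ?_⟩
    exact (norm_sum_smulRight_sq_le e.orthonormal _ t).trans_lt
      ((le_abs_self _).trans_lt (hs t ht))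
  have heq : ∑' i, S i = T := by
    ext x
    have h1 := hsum.hasSum.mapL (ContinuousLinearMap.apply ℝ F x)
    have h2 := (e.hasSum_repr x).mapL T
    refine h1.unique ?_
    simpa [hS, e.repr_apply_apply] using h2
  have hmem : ∀ s : Finset ι, ∑ i ∈ s, S i ∈ compactOperator (RingHom.id ℝ) E F := by
    intro s
    refine Submodule.sum_mem _ fun i _ => ?_
    exact (isCompactOperator_of_locallyCompactSpace_dom (innerSL ℝ (e i))).clm_comp
      (ContinuousLinearMap.toSpanSingleton ℝ (T (e i)))
  rw [← heq]
  exact isClosed_setOfPred_isCompactOperator.mem_of_tendsto hsum.hasSum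
    (Filter.Eventually.of_forall hmem)

variable {a b : ℝ} {k : ℝ × ℝ → ℝ}

/-- For almost every `x`, the values `integralOp hk (e i) x` are the coefficients of the section `k
(x, ·)` along `e i`; Bessel for that section is integrated in `x`. -/
theorem sum_norm_integralOp_sq_le (hk : MemLp k 2 ((volIoo a b).prod (volIoo a b)))
    {ι : Type*} {e : ι → L2Ioo a b} (he : Orthonormal ℝ e) (s : Finset ι) :
    ∑ i ∈ s, ‖integralOp hk (e i)‖ ^ 2 ≤
      ∫ x, ∫ y, k (x, y) ^ 2 ∂(volIoo a b) ∂(volIoo a b) := by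
  simp_rw [norm_sq_L2Ioo]
  rw [← integral_finsetSum _ fun i _ => (Lp.memLp (integralOp hk (e i))).integrable_sq]
  refine integral_mono_ae
    (integrable_finsetSum _ fun i _ => (Lp.memLp (integralOp hk (e i))).integrable_sq)
    hk.integrable_sq.integral_prod_left ?_
  have h1 : ∀ᵐ x ∂(volIoo a b), ∀ i ∈ s,
      integralOp hk (e i) x = ∫ y in Ioo a b, k (x, y) * e i y :=
    (Finset.eventually_all s).2 fun i _ => integralOp_apply_ae hk (e i)
  filter_upwards [kernel_section_memLp hk, h1] with x hx hx1
  have h2 : ∫ y, k (x, y) ^ 2 ∂(volIoo a b) = ‖hx.toLp _‖ ^ 2 := by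
    rw [norm_sq_L2Ioo]
    apply integral_congr_ae
    filter_upwards [hx.coeFn_toLp] with y hy
    rw [hy]
  rw [h2]
  refine le_trans (Finset.sum_le_sum fun i hi => ?_) (he.sum_inner_products_le (hx.toLp _) (s := s))
  rw [hx1 i hi, Real.norm_eq_abs, sq_abs]
  apply le_of_eq
  congr 1
  rw [L2.inner_def]
  apply integral_congr_ae
  filter_upwards [hx.coeFn_toLp] with y hy
  simp [hy]

theorem isCompactOperator_integralOp (hk : MemLp k 2 ((volIoo a b).prod (volIoo a b))) :
    IsCompactOperator (integralOp hk) := by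
  obtain ⟨w, e, -⟩ := exists_hilbertBasis ℝ (L2Ioo a b)
  exact isCompactOperator_of_summable_norm_sq e _
    (summable_of_sum_le (fun i => sq_nonneg _) (sum_norm_integralOp_sq_le hk e.orthonormal))

end HilbertSchmidt

/-! ### Upper bound for the width, and its dual form for optimal subspaces. -/

section Width

variable {E : Type*} [NormedAddCommGroup E] [InnerProductSpace ℝ E]

/-- The complement of the first `n` eigenvectors is invariant under `T`. The restriction is compact
and symmetric, so its norm is its spectral radius, and its nonzero spectrum consists of eigenvalues.
-/
theorem IsEigenSystem.norm_apply_le [CompleteSpace E] {T : E →L[ℝ] E} {lam : ℕ → ℝ} {e : ℕ → E}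
    (h : IsEigenSystem T lam e) (hc : IsCompactOperator T) (hT : T.IsPositive) (n : ℕ) {w : E}
    (hw : w ∈ (Submodule.span ℝ (e '' Iio n))ᗮ) : ‖T w‖ ≤ lam n * ‖w‖ := by
  set V := (Submodule.span ℝ (e '' Iio n))ᗮ with hV
  have hsymm : (T : E →ₗ[ℝ] E).IsSymmetric := hT.isSymmetric
  have hinv : ∀ v ∈ V, T v ∈ V := by
    intro v hv
    rw [hV, Submodule.mem_orthogonal]
    intro u hu
    rw [← (show inner ℝ (T u) v = inner ℝ u (T v) from hsymm u v)]
    refine (Submodule.mem_orthogonal _ _).1 hv _ ?_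
    revert u
    change Submodule.span ℝ (e '' Iio n) ≤ (Submodule.span ℝ (e '' Iio n)).comap (T : E →ₗ[ℝ] E)
    rw [Submodule.span_le]
    rintro _ ⟨i, hi, rfl⟩
    simp only [Submodule.comap_coe, mem_preimage, ContinuousLinearMap.coe_coe, SetLike.mem_coe]
    rw [h.apply_eq]
    exact Submodule.smul_mem _ _ (Submodule.subset_span ⟨i, hi, rfl⟩)
  let S : V →L[ℝ] V := T.restrict hinv
  have hScomp : IsCompactOperator S :=
    IsCompactOperator.restrict' (f := (T : E →ₗ[ℝ] E)) hc hinv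
  have hSsymm : (S : V →ₗ[ℝ] V).IsSymmetric := hsymm.restrict_invariant hinv
  have hnorm : ‖S‖ ≤ lam n := by
    have hr := S.spectralRadius_eq_nnnorm hSsymm.isSelfAdjoint
    have : (‖S‖₊ : ℝ≥0∞) ≤ ((lam n).toNNReal : ℝ≥0∞) := by
      rw [← hr, spectralRadius]
      refine iSup₂_le fun c hcs => ?_
      by_cases hc0 : c = 0
      · simp [hc0]
      have hev := (hScomp.hasEigenvalue_iff_mem_spectrum hc0).2 hcs
      obtain ⟨v, hv, hv0⟩ := hev.exists_hasEigenvector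
      have hTv : T (v : E) = c • (v : E) := by
        have := congrArg Subtype.val (Module.End.mem_eigenspace_iff.1 hv)
        exact this
      have hv0' : (v : E) ≠ 0 := by simpa using hv0
      have hcpos : 0 ≤ c := by
        have h1 := hT.inner_nonneg_left (v : E)
        rw [hTv, real_inner_smul_left, real_inner_self_eq_norm_sq] at h1
        have : 0 < ‖(v : E)‖ ^ 2 := by positivity
        exact nonneg_of_mul_nonneg_left h1 this
      have hcle : c ≤ lam n := by
        -- An eigenvalue above `lam n` can occur only at indices below `n`, so `complete` puts `v`
        -- in the span to which it is orthogonal.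
        by_contra! hlt
        have hmem := h.complete c v hc0 hTv
        have hsub : e '' {l | lam l = c} ⊆ e '' Iio n := by
          refine image_mono fun l hl => ?_
          by_contra hnl
          exact absurd (h.antitone (not_lt.1 hnl)) (by rw [hl]; exact not_le.2 hlt)
        have h2 := Submodule.span_mono hsub hmem
        exact hv0' (inner_self_eq_zero.1 ((Submodule.mem_orthogonal _ _).1 v.2 _ h2))
      rw [ENNReal.coe_le_coe, ← NNReal.coe_le_coe, Real.coe_toNNReal _ (h.nonneg n)]
      simpa [abs_of_nonneg hcpos] using hcle
    rw [ENNReal.coe_le_coe, ← NNReal.coe_le_coe, Real.coe_toNNReal _ (h.nonneg n)] at this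
    exact this
  exact (S.le_opNorm ⟨w, hw⟩).trans (mul_le_mul_of_nonneg_right hnorm (norm_nonneg _))

theorem norm_sub_starProjection_le_of_distE_le {K : E →L[ℝ] E} {U : Submodule ℝ E}
    [FiniteDimensional ℝ U] {s : ℝ} (hs : 0 ≤ s)
    (h : distE (K '' Metric.closedBall 0 1) U ≤ ENNReal.ofReal s) (f : E) :
    ‖K f - U.starProjection (K f)‖ ≤ s * ‖f‖ := by
  rcases eq_or_ne f 0 with rfl | hf
  · simp
  have h1 : ‖K (‖f‖⁻¹ • f) - U.starProjection (K (‖f‖⁻¹ • f))‖ₑ ≤ ENNReal.ofReal s :=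
    (le_iSup₂ (f := fun u (_ : u ∈ K '' Metric.closedBall 0 1) => ‖u - U.starProjection u‖ₑ)
      (K (‖f‖⁻¹ • f)) ⟨_, by simp [norm_smul, hf], rfl⟩).trans h
  rw [← ofReal_norm, ENNReal.ofReal_le_ofReal_iff hs, map_smul, map_smul, ← smul_sub, norm_smul,
    norm_inv, norm_norm, inv_mul_le_iff₀ (norm_pos_iff.2 hf)] at h1
  linarith

variable [CompleteSpace E]

open ContinuousLinearMap in
-- For `w ⟂ U`, `‖K* w‖² = (w, K K* w)`, and the projection of `K K* w` onto `U` can be subtracted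
-- for free.
theorem norm_adjoint_le_of_norm_sub_starProjection_le {K : E →L[ℝ] E} {U : Submodule ℝ E}
    [U.HasOrthogonalProjection] {s : ℝ}
    (h : ∀ f, ‖K f - U.starProjection (K f)‖ ≤ s * ‖f‖) {w : E} (hw : w ∈ Uᗮ) :
    ‖K.adjoint w‖ ≤ s * ‖w‖ := by
  have h1 : ‖K.adjoint w‖ * ‖K.adjoint w‖ ≤ ‖K.adjoint w‖ * (s * ‖w‖) := by
    rw [← real_inner_self_eq_norm_mul_norm, adjoint_inner_left]
    have h2 : inner ℝ w (U.starProjection (K (K.adjoint w))) = 0 := by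
      rw [real_inner_comm]
      exact (Submodule.mem_orthogonal _ _).1 hw _ (U.starProjection_apply_mem _)
    rw [← sub_zero (inner ℝ w _), ← h2, ← inner_sub_right]
    refine (real_inner_le_norm _ _).trans ?_
    have := mul_le_mul_of_nonneg_left (h (K.adjoint w)) (norm_nonneg w)
    linarith
  rcases (norm_nonneg (K.adjoint w)).eq_or_lt with h0 | h0
  · rw [← h0]
    have hs : 0 ≤ s * ‖w‖ := (norm_nonneg _).trans (h w)
    exact hs
  · exact le_of_mul_le_mul_left h1 h0

open ContinuousLinearMap in
theorem norm_sub_starProjection_le_of_norm_adjoint_le {K : E →L[ℝ] E} {U : Submodule ℝ E}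
    [U.HasOrthogonalProjection] {s : ℝ} (hs : 0 ≤ s)
    (h : ∀ w ∈ Uᗮ, ‖K.adjoint w‖ ≤ s * ‖w‖) (f : E) :
    ‖K f - U.starProjection (K f)‖ ≤ s * ‖f‖ := by
  set w := K f - U.starProjection (K f) with hw
  have hwU : w ∈ Uᗮ := U.sub_starProjection_mem_orthogonal _
  rcases (norm_nonneg w).eq_or_lt with h0 | h0
  · rw [← h0]
    positivity
  refine le_of_mul_le_mul_left ?_ h0
  have h2 : inner ℝ w (U.starProjection (K f)) = 0 := by
    rw [real_inner_comm]
    exact (Submodule.mem_orthogonal _ _).1 hwU _ (U.starProjection_apply_mem _)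
  have h3 : ‖w‖ * ‖w‖ = inner ℝ (K.adjoint w) f := by
    rw [← real_inner_self_eq_norm_mul_norm, adjoint_inner_left]
    nth_rw 2 [hw]
    rw [inner_sub_right, h2, sub_zero]
  rw [h3]
  refine (real_inner_le_norm _ _).trans ?_
  have := mul_le_mul_of_nonneg_right (h w hwU) (norm_nonneg f)
  linarith

/-- The eigenfunctions of `K K*` give the bound `d_n(K(B)) ≤ √λ_n`. -/
theorem nWidth_image_closedBall_le {K : E →L[ℝ] E} (hK : IsCompactOperator (K ∘L K.adjoint))
    {lam : ℕ → ℝ} {ψ : ℕ → E}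
    (hψ : IsEigenSystem (K ∘L K.adjoint) lam ψ) (n : ℕ) :
    nWidth n (K '' Metric.closedBall 0 1) ≤ ENNReal.ofReal √(lam n) := by
  set U := Submodule.span ℝ (ψ '' Iio n) with hU
  have hfin : FiniteDimensional ℝ U :=
    FiniteDimensional.span_of_finite ℝ ((finite_Iio n).image ψ)
  -- `nWidth` ranges over dimension exactly `n`, which orthonormality of `ψ` supplies.
  have hrank : Module.finrank ℝ U = n := by
    have h1 := finrank_span_eq_card (R := ℝ)
      (hψ.orthonormal.comp (Fin.val : Fin n → ℕ) Fin.val_injective).linearIndependent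
    rw [range_comp, Fin.range_val, Fintype.card_fin] at h1
    exact h1
  have hadj : ∀ w ∈ Uᗮ, ‖K.adjoint w‖ ≤ √(lam n) * ‖w‖ := by
    intro w hw
    refine le_of_sq_le_sq ?_ (by positivity)
    rw [mul_pow, Real.sq_sqrt (hψ.nonneg n), ← real_inner_self_eq_norm_sq,
      ContinuousLinearMap.adjoint_inner_left]
    refine (real_inner_le_norm _ _).trans ?_
    have := hψ.norm_apply_le hK (ContinuousLinearMap.isPositive_self_comp_adjoint K) n hw
    have := mul_le_mul_of_nonneg_left this (norm_nonneg w)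
    simp only [ContinuousLinearMap.comp_apply] at this
    linarith
  refine (iInf₂_le U hfin).trans ((iInf_le _ hrank).trans ?_)
  refine iSup₂_le ?_
  rintro _ ⟨f, hf, rfl⟩
  rw [← ofReal_norm]
  refine ENNReal.ofReal_le_ofReal
    ((norm_sub_starProjection_le_of_norm_adjoint_le (Real.sqrt_nonneg _) hadj f).trans ?_)
  exact mul_le_of_le_one_right (Real.sqrt_nonneg _) (by simpa using hf)

/-- If `X` is optimal for the width of `K(B)` then `‖K* w‖ ≤ √λ_n ‖w‖` on `Xᗮ`. -/
theorem IsOptimalSubspace.norm_adjoint_le {K : E →L[ℝ] E} (hK : IsCompactOperator (K ∘L K.adjoint))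
    {lam : ℕ → ℝ} {ψ : ℕ → E}
    (hψ : IsEigenSystem (K ∘L K.adjoint) lam ψ) {n : ℕ} {X : Submodule ℝ E}
    [FiniteDimensional ℝ X] (hX : IsOptimalSubspace n (K '' Metric.closedBall 0 1) X) :
    ∀ w ∈ Xᗮ, ‖K.adjoint w‖ ≤ √(lam n) * ‖w‖ := fun _ hw =>
  norm_adjoint_le_of_norm_sub_starProjection_le
    (norm_sub_starProjection_le_of_distE_le (Real.sqrt_nonneg _)
      (hX.2.symm.le.trans (nWidth_image_closedBall_le hK hψ n))) hw

end Width
-- Propagation of the bounds through the spaces, and approximation of eigenfunctions.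
section Superconvergence

variable {E : Type*} [NormedAddCommGroup E] [InnerProductSpace ℝ E] [CompleteSpace E]

open ContinuousLinearMap

theorem mem_orthogonal_of_mem_orthogonal_map {L : E →L[ℝ] E} {U : Submodule ℝ E} {w : E}
    (hw : w ∈ (U.map (L : E →ₗ[ℝ] E))ᗮ) : L.adjoint w ∈ Uᗮ := by
  rw [Submodule.mem_orthogonal] at hw ⊢
  intro u hu
  rw [adjoint_inner_right]
  exact hw _ (Submodule.mem_map_of_mem hu)

/-- Since `L* w ⟂ U`, `‖L* w‖² = (w, L L* w) ≤ ‖w‖ · s ‖L* w‖`; the constant does not deteriorate.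
-/
theorem norm_adjoint_le_of_mem_orthogonal_map {L : E →L[ℝ] E} {U : Submodule ℝ E} {s : ℝ}
    (hs : 0 ≤ s) (h : ∀ z ∈ Uᗮ, ‖L z‖ ≤ s * ‖z‖) {w : E} (hw : w ∈ (U.map (L : E →ₗ[ℝ] E))ᗮ) :
    ‖L.adjoint w‖ ≤ s * ‖w‖ := by
  have hz := h _ (mem_orthogonal_of_mem_orthogonal_map hw)
  rcases (norm_nonneg (L.adjoint w)).eq_or_lt with h0 | h0
  · rw [← h0]
    positivity
  refine le_of_mul_le_mul_left ?_ h0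
  have h1 : ‖L.adjoint w‖ * ‖L.adjoint w‖ = inner ℝ w (L (L.adjoint w)) := by
    rw [← real_inner_self_eq_norm_mul_norm, adjoint_inner_left]
  rw [h1]
  refine (real_inner_le_norm _ _).trans ?_
  have := mul_le_mul_of_nonneg_left hz (norm_nonneg w)
  linarith

/-- All the spaces `𝕏_q`, `𝕐_q` inherit the bound satisfied by `𝕏_0`, `𝕐_0`. -/
theorem norm_apply_le_of_mem_orthogonal_space {K : E →L[ℝ] E} {X₀ Y₀ : Submodule ℝ E} {s : ℝ}
    (hs : 0 ≤ s) (hX : ∀ w ∈ X₀ᗮ, ‖K.adjoint w‖ ≤ s * ‖w‖) (hY : ∀ w ∈ Y₀ᗮ, ‖K w‖ ≤ s * ‖w‖)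
    (q : ℕ) :
    (∀ w ∈ (spaceX K X₀ Y₀ q)ᗮ, ‖K.adjoint w‖ ≤ s * ‖w‖) ∧
      (∀ w ∈ (spaceY K X₀ Y₀ q)ᗮ, ‖K w‖ ≤ s * ‖w‖) := by
  induction q with
  | zero => exact ⟨hX, hY⟩
  | succ q ih =>
    refine ⟨fun w hw => norm_adjoint_le_of_mem_orthogonal_map hs ih.2 hw, fun w hw => ?_⟩
    have := norm_adjoint_le_of_mem_orthogonal_map (L := K.adjoint) hs ih.1 hw
    rwa [adjoint_adjoint] at this

theorem norm_apply_of_eigen {L : E →L[ℝ] E} {μ : ℝ} {v : E} (hμ : 0 ≤ μ)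
    (hv : L.adjoint (L v) = μ • v) : ‖L v‖ = √μ * ‖v‖ := by
  rw [← Real.sqrt_sq (norm_nonneg (L v)), ← real_inner_self_eq_norm_sq, ← adjoint_inner_left, hv,
    real_inner_smul_left, real_inner_self_eq_norm_sq, Real.sqrt_mul hμ,
    Real.sqrt_sq (norm_nonneg v)]

/-- With `z` the projection error, `μ ‖z‖² = (z, L*L v) = (L z, L v)`. The factor `c` records what
is gained beyond Cauchy–Schwarz: `1` at level zero, the previous level's relative error afterwards.
-/
theorem norm_le_of_inner_apply {L : E →L[ℝ] E} {U : Submodule ℝ E} [U.HasOrthogonalProjection]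
    {s μ c : ℝ} (hs : 0 ≤ s) (hμ : 0 < μ) (h : ∀ z ∈ Uᗮ, ‖L z‖ ≤ s * ‖z‖) {v : E}
    (hv : L.adjoint (L v) = μ • v) (hc : 0 ≤ c)
    (hin : ∀ z ∈ Uᗮ, inner ℝ (L z) (L v) ≤ ‖L z‖ * (c * ‖L v‖)) :
    ‖v - U.starProjection v‖ ≤ s / √μ * c * ‖v‖ := by
  set z := v - U.starProjection v with hz
  have hzU : z ∈ Uᗮ := U.sub_starProjection_mem_orthogonal _
  have h1 : μ * (‖z‖ * ‖z‖) = inner ℝ (L z) (L v) := by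
    rw [← adjoint_inner_right, hv, real_inner_smul_right, ← real_inner_self_eq_norm_mul_norm]
    congr 1
    nth_rw 2 [hz]
    rw [inner_sub_right, real_inner_comm (U.starProjection v),
      (Submodule.mem_orthogonal _ _).1 hzU _ (U.starProjection_apply_mem _), sub_zero]
  have h2 : μ * (‖z‖ * ‖z‖) ≤ (s * ‖z‖) * (c * (√μ * ‖v‖)) := by
    rw [h1, ← norm_apply_of_eigen hμ.le hv]
    exact (hin z hzU).trans (mul_le_mul_of_nonneg_right (h z hzU) (by positivity))
  have hsq : √μ * √μ = μ := Real.mul_self_sqrt hμ.le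
  have hpos := Real.sqrt_pos.2 hμ
  rcases (norm_nonneg z).eq_or_lt with h0 | h0
  · rw [← h0]
    positivity
  have h3 : √μ * ‖z‖ ≤ s * c * ‖v‖ := by
    refine le_of_mul_le_mul_left ?_ (mul_pos hpos h0)
    calc √μ * ‖z‖ * (√μ * ‖z‖) = √μ * √μ * (‖z‖ * ‖z‖) := by ring
      _ ≤ (s * ‖z‖) * (c * (√μ * ‖v‖)) := by rwa [hsq]
      _ = _ := by ring
  rw [div_mul_eq_mul_div, div_mul_eq_mul_div, le_div_iff₀ hpos]
  linarith

/-- Approximation of eigenfunctions by `𝕏_q` and `𝕐_q`. -/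
theorem norm_eigen_sub_starProjection_le {K : E →L[ℝ] E} {X₀ Y₀ : Submodule ℝ E}
    [FiniteDimensional ℝ X₀] [FiniteDimensional ℝ Y₀] {s μ : ℝ} (hs : 0 ≤ s) (hμ : 0 < μ)
    (hX : ∀ w ∈ X₀ᗮ, ‖K.adjoint w‖ ≤ s * ‖w‖) (hY : ∀ w ∈ Y₀ᗮ, ‖K w‖ ≤ s * ‖w‖) (q : ℕ) :
    (∀ v, K (K.adjoint v) = μ • v →
      ‖v - (spaceX K X₀ Y₀ q).starProjection v‖ ≤ (s / √μ) ^ (q + 1) * ‖v‖) ∧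
    (∀ v, K.adjoint (K v) = μ • v →
      ‖v - (spaceY K X₀ Y₀ q).starProjection v‖ ≤ (s / √μ) ^ (q + 1) * ‖v‖) := by
  have step : ∀ (L : E →L[ℝ] E) (U W : Submodule ℝ E) [U.HasOrthogonalProjection]
      [W.HasOrthogonalProjection] (c : ℝ), 0 ≤ c → (∀ z ∈ Wᗮ, ‖L z‖ ≤ s * ‖z‖) →
      (∀ z ∈ Wᗮ, L z ∈ Uᗮ) →
      (∀ v, L (L.adjoint v) = μ • v → ‖v - U.starProjection v‖ ≤ c * ‖v‖) →
      ∀ v, L.adjoint (L v) = μ • v → ‖v - W.starProjection v‖ ≤ s / √μ * c * ‖v‖ := by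
    intro L U W _ _ c hc hW hWU hU v hv
    refine norm_le_of_inner_apply hs hμ hW hv hc fun z hz => ?_
    -- As `L z ⟂ U`, only the error `L v - U (L v)` pairs with `L z`.
    have h0 : inner ℝ (L z) (U.starProjection (L v)) = 0 := by
      rw [real_inner_comm]
      exact (Submodule.mem_orthogonal _ _).1 (hWU z hz) _ (U.starProjection_apply_mem _)
    rw [← sub_zero (inner ℝ _ _), ← h0, ← inner_sub_right]
    refine (real_inner_le_norm _ _).trans (mul_le_mul_of_nonneg_left (hU _ ?_) (norm_nonneg _))
    -- `L v` is an eigenvector of `L L*` for the same `μ`, so the previous level applies to it.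
    rw [hv, map_smul]
  have base : ∀ (L : E →L[ℝ] E) (W : Submodule ℝ E) [W.HasOrthogonalProjection],
      (∀ z ∈ Wᗮ, ‖L z‖ ≤ s * ‖z‖) →
      ∀ v, L.adjoint (L v) = μ • v → ‖v - W.starProjection v‖ ≤ (s / √μ) ^ (0 + 1) * ‖v‖ := by
    intro L W _ hW v hv
    have := norm_le_of_inner_apply hs hμ hW hv zero_le_one fun z _ => by
      rw [one_mul]; exact real_inner_le_norm _ _
    simpa using this
  have hbd := norm_apply_le_of_mem_orthogonal_space hs hX hY
  induction q with
  | zero =>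
    refine ⟨fun v hv => base K.adjoint X₀ hX v ?_, base K Y₀ hY⟩
    rwa [adjoint_adjoint]
  | succ q ih =>
    have hc : 0 ≤ (s / √μ) ^ (q + 1) := by positivity
    rw [pow_succ' _ (q + 1)]
    refine ⟨fun v hv => step K.adjoint (spaceY K X₀ Y₀ q) (spaceX K X₀ Y₀ (q + 1)) _ hc
      (hbd _).1 (fun z hz => mem_orthogonal_of_mem_orthogonal_map hz) ?_ v ?_,
      step K (spaceX K X₀ Y₀ q) (spaceY K X₀ Y₀ (q + 1)) _ hc
      (hbd _).2 (fun z hz => ?_) ih.1⟩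
    · rw [adjoint_adjoint]; exact ih.2
    · rwa [adjoint_adjoint]
    · have := mem_orthogonal_of_mem_orthogonal_map (L := K.adjoint) hz
      rwa [adjoint_adjoint] at this

theorem adjoint_apply_mem_ker_orthogonal (L : E →L[ℝ] E) (u : E) :
    L.adjoint u ∈ (LinearMap.ker (L : E →ₗ[ℝ] E))ᗮ := by
  rw [Submodule.mem_orthogonal]
  intro v hv
  rw [adjoint_inner_right, show L v = 0 from hv, inner_zero_left]

/-- Keeps the projection errors in the subspaces where `∂` inverts `K` or `-K*`. -/
theorem space_le_ker_orthogonal {K : E →L[ℝ] E} {X₀ Y₀ : Submodule ℝ E}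
    (hX : X₀ ⟂ LinearMap.ker (K.adjoint : E →ₗ[ℝ] E)) (hY : Y₀ ⟂ LinearMap.ker (K : E →ₗ[ℝ] E))
    (q : ℕ) :
    spaceX K X₀ Y₀ q ≤ (LinearMap.ker (K.adjoint : E →ₗ[ℝ] E))ᗮ ∧
      spaceY K X₀ Y₀ q ≤ (LinearMap.ker (K : E →ₗ[ℝ] E))ᗮ := by
  cases q with
  | zero => exact ⟨hX, hY⟩
  | succ q =>
    constructor
    · rintro _ ⟨u, -, rfl⟩
      have := adjoint_apply_mem_ker_orthogonal K.adjoint u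
      rwa [adjoint_adjoint] at this
    · rintro _ ⟨u, -, rfl⟩
      exact adjoint_apply_mem_ker_orthogonal K u

end Superconvergence

/-! ### Weak derivatives and the Ritz error. -/

section WeakDerivative

variable {a b : ℝ}

theorem HasWeakDeriv.smul {u v : L2Ioo a b} (h : HasWeakDeriv u v) (c : ℝ) :
    HasWeakDeriv (c • u) (c • v) := by
  intro η h1 h2 h3
  have e1 : ∫ x in Ioo a b, (c • u) x * deriv η x = c * ∫ x in Ioo a b, u x * deriv η x := by
    rw [← integral_const_mul]
    apply integral_congr_ae
    filter_upwards [Lp.coeFn_smul c u] with x hx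
    rw [hx, Pi.smul_apply, smul_eq_mul, mul_assoc]
  have e2 : ∫ x in Ioo a b, (c • v) x * η x = c * ∫ x in Ioo a b, v x * η x := by
    rw [← integral_const_mul]
    apply integral_congr_ae
    filter_upwards [Lp.coeFn_smul c v] with x hx
    rw [hx, Pi.smul_apply, smul_eq_mul, mul_assoc]
  rw [e1, e2, h η h1 h2 h3, mul_neg]

theorem hasWeakDeriv_of_forall_unit {L : L2Ioo a b →L[ℝ] L2Ioo a b} {V : Submodule ℝ (L2Ioo a b)}
    {σ : ℝ} (h : ∀ f, ‖f‖ ≤ 1 → f ∈ V → HasWeakDeriv (L f) (σ • f)) {f : L2Ioo a b} (hf : f ∈ V) :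
    HasWeakDeriv (L f) (σ • f) := by
  rcases eq_or_ne f 0 with rfl | h0
  · exact h 0 (by simp) hf
  have h1 := (h (‖f‖⁻¹ • f) (by simp [norm_smul, h0]) (V.smul_mem _ hf)).smul ‖f‖
  rwa [map_smul, smul_comm σ, smul_inv_smul₀ (norm_ne_zero_iff.2 h0),
    smul_inv_smul₀ (norm_ne_zero_iff.2 h0)] at h1

/-- Error of the Ritz projection `σ L U ∂` of an eigenfunction `w` of `L L*`, when `∂ L = σ` on
`(ker L)ᗮ`. -/
theorem ritz_error_le {L : L2Ioo a b →L[ℝ] L2Ioo a b} {σ s μ : ℝ} (hσ : σ * σ = 1) (hs : 0 ≤ s)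
    (hμ : 0 < μ)
    (hD : ∀ f ∈ (LinearMap.ker (L : L2Ioo a b →ₗ[ℝ] L2Ioo a b))ᗮ, HasWeakDeriv (L f) (σ • f))
    {w : L2Ioo a b} (hw : L (L.adjoint w) = μ • w) (hw1 : ‖w‖ = 1)
    {U : Submodule ℝ (L2Ioo a b)} [U.HasOrthogonalProjection]
    (hUker : U ≤ (LinearMap.ker (L : L2Ioo a b →ₗ[ℝ] L2Ioo a b))ᗮ)
    (hU : ∀ z ∈ Uᗮ, ‖L z‖ ≤ s * ‖z‖) {p : ℕ}
    (hUe : ∀ v, L.adjoint (L v) = μ • v → ‖v - U.starProjection v‖ ≤ (s / √μ) ^ p * ‖v‖)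
    {R : L2Ioo a b} (hR : R = σ • L (U.starProjection (weakDeriv w))) :
    w ∈ LinearMap.range (L : L2Ioo a b →ₗ[ℝ] L2Ioo a b) ∧ MemH1 w ∧ MemH1 (w - R) ∧ w ≠ 0 ∧
      weakDeriv w ≠ 0 ∧ ‖w - R‖ / ‖w‖ ≤ (s / √μ) ^ (p + 1) ∧
      ‖weakDeriv (w - R)‖ / ‖weakDeriv w‖ ≤ (s / √μ) ^ p := by
  -- The preimage of `w` under `L` orthogonal to `ker L`; it is an eigenvector of `L* L` with `√μ
  -- ‖g‖ = 1`.
  set g := μ⁻¹ • L.adjoint w with hg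
  have hLg : L g = w := by rw [hg, map_smul, hw, inv_smul_smul₀ hμ.ne']
  have hgker : g ∈ (LinearMap.ker (L : L2Ioo a b →ₗ[ℝ] L2Ioo a b))ᗮ :=
    Submodule.smul_mem _ _ (adjoint_apply_mem_ker_orthogonal L w)
  have hge : L.adjoint (L g) = μ • g := by rw [hLg, hg, smul_inv_smul₀ hμ.ne']
  have hw0 : w ≠ 0 := by rintro rfl; simp at hw1
  have hgn : √μ * ‖g‖ = 1 := by rw [← norm_apply_of_eigen hμ.le hge, hLg, hw1]
  have hσn : ‖σ‖ = 1 := by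
    rcases mul_self_eq_one_iff.1 hσ with rfl | rfl <;> simp
  have hdw : HasWeakDeriv w (σ • g) := hLg ▸ hD g hgker
  have hdw' := hdw.weakDeriv_eq
  set z := g - U.starProjection g with hz
  have hzU : z ∈ Uᗮ := U.sub_starProjection_mem_orthogonal _
  have hzker : z ∈ (LinearMap.ker (L : L2Ioo a b →ₗ[ℝ] L2Ioo a b))ᗮ :=
    Submodule.sub_mem _ hgker (hUker (U.starProjection_apply_mem _))
  -- The two signs cancel through `σ * σ = 1`.
  have hwR : w - R = L z := by
    rw [hR, hdw', map_smul, map_smul, smul_smul, hσ, one_smul, hz, map_sub, hLg]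
  have hdR : HasWeakDeriv (w - R) (σ • z) := hwR ▸ hD z hzker
  have hzn := hUe g hge
  have hgpos : 0 < ‖g‖ := by
    by_contra! h
    rw [le_antisymm h (norm_nonneg _), mul_zero] at hgn
    exact zero_ne_one hgn
  have hpos := Real.sqrt_pos.2 hμ
  refine ⟨⟨g, hLg⟩, ⟨_, hdw⟩, ⟨_, hdR⟩, hw0, ?_, ?_, ?_⟩
  · rw [hdw', ← norm_ne_zero_iff, norm_smul, hσn, one_mul]
    exact hgpos.ne'
  · rw [hw1, div_one, hwR]
    calc ‖L z‖ ≤ s * ‖z‖ := hU z hzU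
      _ ≤ s * ((s / √μ) ^ p * ‖g‖) := mul_le_mul_of_nonneg_left hzn hs
      _ = (s / √μ) ^ (p + 1) * (√μ * ‖g‖) := by
        rw [pow_succ]; field_simp
      _ = _ := by rw [hgn, mul_one]
  · rw [hdR.weakDeriv_eq, hdw', norm_smul, norm_smul, hσn, one_mul, one_mul,
      div_le_iff₀ hgpos]
    exact hzn

end WeakDerivative

theorem sqrt_div_sqrt_pow {x y : ℝ} (hx : 0 ≤ x) (hy : 0 ≤ y) (m : ℕ) :
    (√x / √y) ^ m = (x / y) ^ ((m : ℝ) / 2) := by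
  rw [← Real.sqrt_div hx, Real.sqrt_eq_rpow, ← Real.rpow_mul_natCast (div_nonneg hx hy)]
  congr 1
  ring

theorem mainTheorem9 {a b : ℝ} (hab : a < b) {k : ℝ × ℝ → ℝ}
    (hk : MemLp k 2 ((volIoo a b).prod (volIoo a b)))
    (K : L2Ioo a b →L[ℝ] L2Ioo a b) (hK : K = integralOp hk)
    (hderiv : DerivInvertsOp K)
    (lam : ℕ → ℝ) (φ ψ : ℕ → L2Ioo a b)
    (hφ : IsEigenSystem (K.adjoint ∘L K) lam φ)
    (hψ : IsEigenSystem (K ∘L K.adjoint) lam ψ)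
    (n : ℕ) (X₀ Y₀ : Submodule ℝ (L2Ioo a b))
    [FiniteDimensional ℝ X₀] [FiniteDimensional ℝ Y₀]
    (hX₀ : IsOptimalSubspace n (classA K 1) X₀)
    (hY₀ : IsOptimalSubspace n (classAstar K 1) Y₀)
    (hX₀ker : X₀ ⟂ LinearMap.ker (K.adjoint : L2Ioo a b →ₗ[ℝ] L2Ioo a b))
    (hY₀ker : Y₀ ⟂ LinearMap.ker (K : L2Ioo a b →ₗ[ℝ] L2Ioo a b))
    (p : ℕ) (hp : 1 ≤ p) (l : ℕ) (hl : 0 < lam l) :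
    (ψ l ∈ LinearMap.range (K : L2Ioo a b →ₗ[ℝ] L2Ioo a b) ∧
      MemH1 (ψ l) ∧ MemH1 (ψ l - ritzX K X₀ Y₀ p (ψ l)) ∧
      ψ l ≠ 0 ∧ weakDeriv (ψ l) ≠ 0 ∧
      ‖ψ l - ritzX K X₀ Y₀ p (ψ l)‖ / ‖ψ l‖ ≤ (lam n / lam l) ^ (((p : ℝ) + 1) / 2) ∧
      ‖weakDeriv (ψ l - ritzX K X₀ Y₀ p (ψ l))‖ / ‖weakDeriv (ψ l)‖ ≤
        (lam n / lam l) ^ ((p : ℝ) / 2)) ∧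
    (φ l ∈ LinearMap.range (K.adjoint : L2Ioo a b →ₗ[ℝ] L2Ioo a b) ∧
      MemH1 (φ l) ∧ MemH1 (φ l - ritzY K X₀ Y₀ p (φ l)) ∧
      φ l ≠ 0 ∧ weakDeriv (φ l) ≠ 0 ∧
      ‖φ l - ritzY K X₀ Y₀ p (φ l)‖ / ‖φ l‖ ≤ (lam n / lam l) ^ (((p : ℝ) + 1) / 2) ∧
      ‖weakDeriv (φ l - ritzY K X₀ Y₀ p (φ l))‖ / ‖weakDeriv (φ l)‖ ≤
        (lam n / lam l) ^ ((p : ℝ) / 2)) := by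
  have hKc : IsCompactOperator K := hK ▸ isCompactOperator_integralOp hk
  have hs : 0 ≤ √(lam n) := Real.sqrt_nonneg _
  have hψ' : ∀ i, K (K.adjoint (ψ i)) = lam i • ψ i := hψ.apply_eq
  have hφ' : ∀ i, K.adjoint (K (φ i)) = lam i • φ i := hφ.apply_eq
  -- Indices start at zero: `lam n` is the eigenvalue written `λ_{n+1}`.
  have hX := hX₀.norm_adjoint_le (hKc.comp_clm K.adjoint) hψ
  have hY : ∀ w ∈ Y₀ᗮ, ‖K w‖ ≤ √(lam n) * ‖w‖ := by
    have h := hY₀.norm_adjoint_le (K := K.adjoint) (lam := lam) (ψ := φ)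
    rw [ContinuousLinearMap.adjoint_adjoint] at h
    exact h (hKc.clm_comp K.adjoint) hφ
  -- The Ritz projectors of level `p` use the spaces of level `q`, whose error exponent `q + 1` is
  -- `p`.
  obtain ⟨q, rfl⟩ : ∃ q, p = q + 1 := ⟨p - 1, by omega⟩
  have hbd := norm_apply_le_of_mem_orthogonal_space hs hX hY q
  have hap := norm_eigen_sub_starProjection_le hs hl hX hY q
  have hker := space_le_ker_orthogonal hX₀ker hY₀ker q
  have e1 : ((q + 1 : ℕ) : ℝ) + 1 = ((q + 1 + 1 : ℕ) : ℝ) := by push_cast; ring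
  rw [e1, ← sqrt_div_sqrt_pow (hψ.nonneg n) hl.le, ← sqrt_div_sqrt_pow (hψ.nonneg n) hl.le]
  constructor
  · refine ritz_error_le (σ := 1) (one_mul 1) hs hl (fun f hf => ?_) (hψ' l)
      (hψ.orthonormal.norm_eq_one l) hker.2 hbd.2 hap.2 ?_
    -- The class at `r = 0` is the unit ball of `(ker K)ᗮ`; scaling extends the derivative identity
    -- to the whole subspace.
    · refine hasWeakDeriv_of_forall_unit (fun f h1 h2 => ?_) hf
      rw [one_smul]
      exact (hderiv 0).1 f ⟨h1, h2⟩
    · rw [one_smul]; rfl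
  · refine ritz_error_le (L := K.adjoint) (σ := -1) (by norm_num) hs hl (fun f hf => ?_)
      (by rw [ContinuousLinearMap.adjoint_adjoint]; exact hφ' l)
      (hφ.orthonormal.norm_eq_one l) hker.1 hbd.1
      (by rw [ContinuousLinearMap.adjoint_adjoint]; exact hap.1) ?_
    · refine hasWeakDeriv_of_forall_unit (fun f h1 h2 => ?_) hf
      rw [neg_one_smul]
      exact (hderiv 0).2 f ⟨h1, h2⟩
    · rw [neg_one_smul]; rfl
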